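/- Let $K \subset F$ be differential fields of characteristic $0$ with the same field of constants $C$ (that is, every $c\in F$ with $c'=0$ lies in $K$). For a differential field $A$ with $K\subset A\subset F$ and $y\in F$, write $A\langle y\rangle$ for the smallest differential subfield of $F$ containing $A$ and $y$. The element $y\in F$ is called - an *integral over $A$* if $y'\in A$; - an *exponential of an integral over $A$* if $y'=ay$ for some $a\in A$; - a *special transcendental element over $A$* if $y$ is transcendental over $A$ and $y'=\dfrac{y\,P(y)}{Q(y)}$ for some polynomials $P,Q\in A[X]$, $Q\neq 0$, such that $X P$ and $Q$ are relatively prime. A differential field $E$ with $K\subset E\subset F$ is an *admissible extension* of $K$ if there is a chain of differential fields $K=K_0\subset K_1\subset\dots\subset K_m=E$ such that for each $i<m$ one has $K_{i+1}=K_i\langle y_i\rangle$ for some special transcendental element $y_i$ over $K_i$. Let $n\ge 0$ and $a_0,\dots,a_n\in K$ with $a_n\neq0$, and consider the homogeneous linear differential equation $$a_n y^{(n)}+a_{n-1}y^{(n-1)}+\dots+a_1y'+a_0y=0. \qquad (*)$$ A differential field $E$ with $K\subset E\subset F$ *contains all solutions* of $(*)$ if it contains $n$ solutions that are linearly independent over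 $C$, and every solution of $(*)$ in $F$ lies in $E$. **Theorem.** If some admissible extension $E\subset F$ of $K$ contains all solutions of $(*)$, then there is a chain of differential fields $K=K_0\subset K_1\subset\dots\subset K_m=\tilde E\subset F$ such that $\tilde E$ contains all solutions of $(*)$ and, for each $i<m$, $K_{i+1}=K_i\langle y_i\rangle$, where $y_i$ is either an integral over $K_i$ or an exponential of an integral over $K_i$ that is transcendental over $K_i$. -/

import Mathlib

open scoped Differential Polynomial

namespace LinODE

/-- The field of constants `{c | c′ = 0}` of a differential field. -/
def constants (F : Type*) [Field F] [Differential F] : Subfield F where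
  carrier := {c | c′ = 0}
  zero_mem' := by simp
  one_mem' := by simp
  add_mem' := by
    intro a b (ha : a′ = 0) (hb : b′ = 0)
    show (a + b)′ = 0
    simp [ha, hb]
  mul_mem' := by
    intro a b (ha : a′ = 0) (hb : b′ = 0)
    show (a * b)′ = 0
    simp [ha, hb]
  neg_mem' := by
    intro a (ha : a′ = 0)
    show (-a)′ = 0
    simp [ha]
  inv_mem' := by
    intro a (ha : a′ = 0)
    show (a⁻¹)′ = 0
    simp [Derivation.leibniz_inv, ha]

section Extensions

variable {K F : Type*} [Field K] [Field F] [Differential F] [Algebra K F]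

/-- An intermediate field that is closed under differentiation. -/
def IsDifferential (E : IntermediateField K F) : Prop :=
  ∀ x ∈ E, x′ ∈ E

/-- `A⟨y⟩`: the smallest differential subfield of `F` containing `A` and `y`. -/
def diffAdjoin (A : IntermediateField K F) (y : F) : IntermediateField K F :=
  sInf {B | IsDifferential B ∧ A ≤ B ∧ y ∈ B}

/-- `y` is an integral over `A`: `y′ = a` for some `a ∈ A`. -/
def IsIntegralOver (A : IntermediateField K F) (y : F) : Prop :=
  ∃ a ∈ A, y′ = a

/-- `y` is an exponential of an integral over `A`: `y′ = a y` for some `a ∈ A`. -/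
def IsExpIntegralOver (A : IntermediateField K F) (y : F) : Prop :=
  ∃ a ∈ A, y′ = a * y

/-- `y` is a special transcendental element over `A`: it is transcendental over `A` and
`y′ = y P(y) / Q(y)` for polynomials `P, Q` over `A` such that `X P` and `Q` are relatively
prime. -/
def IsSpecialTranscendental (A : IntermediateField K F) (y : F) : Prop :=
  Transcendental A y ∧
    ∃ P Q : A[X], Q ≠ 0 ∧ IsCoprime (Polynomial.X * P) Q ∧
      y′ = Polynomial.aeval y (Polynomial.X * P) / Polynomial.aeval y Q

/-- There is a chain `K = K₀ ⊆ K₁ ⊆ ⋯ ⊆ Kₘ = E` of differential subfields of `F` such that each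
`Kᵢ₊₁ = Kᵢ⟨y⟩` is obtained by adjoining to `Kᵢ` one element `y` with `Allowed Kᵢ y`. -/
def HasChain (Allowed : IntermediateField K F → F → Prop) (E : IntermediateField K F) : Prop :=
  ∃ (m : ℕ) (c : Fin (m + 1) → IntermediateField K F),
    c 0 = ⊥ ∧ c (Fin.last m) = E ∧ (∀ i, IsDifferential (c i)) ∧
      ∀ i : Fin m, ∃ y : F, Allowed (c i.castSucc) y ∧ c i.succ = diffAdjoin (c i.castSucc) y

/-- `K ⊆ E` is an admissible extension. -/
def IsAdmissible (E : IntermediateField K F) : Prop :=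
  HasChain IsSpecialTranscendental E

/-- `K ⊆ E` is obtained by a chain of extensions by integrals and by transcendental exponentials
of integrals. -/
def IsIntegralTransExpExtension (E : IntermediateField K F) : Prop :=
  HasChain (fun A y => IsIntegralOver A y ∨ (IsExpIntegralOver A y ∧ Transcendental A y)) E

/-- `y` solves `aₙ y⁽ⁿ⁾ + ⋯ + a₁ y′ + a₀ y = 0`. -/
def IsSolution {n : ℕ} (a : Fin (n + 1) → K) (y : F) : Prop :=
  ∑ i : Fin (n + 1), algebraMap K F (a i) * (fun x : F => x′)^[(i : ℕ)] y = 0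

/-- `E` contains all solutions of the equation of order `n` with coefficients `a`. The solutions
form an `n`-dimensional space over the constants: there are `n` solutions in `E` which are
linearly independent over the constants, and every solution in `F` is in `E`. -/
def ContainsAllSolutions {n : ℕ} (a : Fin (n + 1) → K) (E : IntermediateField K F) : Prop :=
  (∃ v : Fin n → F, LinearIndependent (constants F) v ∧ ∀ i, IsSolution a (v i) ∧ v i ∈ E) ∧
    ∀ y : F, IsSolution a y → y ∈ E

end Extensions

end LinODE

/-!
Write `L` for the operator of the equation and `d` for the derivation. The idea is that an
admissible extension produces first-order factors of `L` over the ground field `K` itself, and that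
a linear equation which factors completely over `K` is solved by exponentials and integrals.

* `L` is divisible on the right by `d - β` exactly when `β` solves the Riccati equation of `L`
  (`linOp_eq_comp`), and `f′ / f` solves it for every solution `f ≠ 0` of the equation
  (`riccati_logDeriv`).
* Let `y` be special transcendental over `A`. Since `y′ = y P(y) / Q(y)` with `Q(0) ≠ 0`, the local
  ring of `A(y)` at `y = 0` and its maximal ideal are stable under `d`, so evaluation at `y = 0`
  commutes with `d` (`SpecializesTo.deriv`). A solution in `A(y)` of the Riccati equation has no
  pole at `y = 0`, because its leading term could not cancel, and its value there is a solution
  in `A` (`exists_riccati_of_special`). Descending along the admissible chain gives a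
  solution `β` in `K`.
* So `L = L₁ (d - β)` over `K`. Counting dimensions over the constants, `f′ = β f` has a nonzero
  solution `f` among the solutions of `L`, and `d - β` maps these onto the solutions of `L₁`
  (`full_of_comp`). By induction on the order there are exponentials `f₁, …, fₙ` of integrals
  over `K`, all in the admissible extension, over which the solutions are found by integrations,
  since `(x / f)′ = (x′ - β x) / f` (`exists_exponentials`).
* `K` is closed under radicals in an admissible extension, so the group generated by the `fᵢ` is
  torsion-free modulo `Kˣ` and has a basis there. Exponentials that are multiplicatively
  independent modulo `Kˣ` are algebraically independent over `K`, as there are no new constants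
  (`algebraicIndependent_of_expUnits`). Adjoining the basis elements one at a time therefore gives
  a tower of transcendental exponentials that contains all `fᵢ`
  (`exists_tower_of_exponentials`).
-/

namespace LinODE

/-! ### Linear operators and their first-order right factors -/

section Operators

variable {F : Type*} [Field F] [Differential F]

/-- The derivation of `F` as a linear map over the constants. -/
def derivLin : F →ₗ[constants F] F where
  toFun x := (x′)
  map_add' := by simp
  map_smul' c x := by
    have hc : (c : F)′ = 0 := c.2
    simp [Subfield.smul_def, Derivation.leibniz, hc]

@[simp] lemma derivLin_apply (x : F) : derivLin x = x′ := rfl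

/-- The operator `f ↦ f′ - β f`. -/
def firstOrder (β : F) : F →ₗ[constants F] F := derivLin - β • LinearMap.id

@[simp] lemma firstOrder_apply (β x : F) : firstOrder β x = x′ - β * x := by
  simp [firstOrder]

/-- The operator `f ↦ a₀ f + a₁ f′ + ⋯ + aₙ f⁽ⁿ⁾`; the coefficients of index above `n` are
ignored. -/
def linOp (a : ℕ → F) (n : ℕ) : F →ₗ[constants F] F :=
  ∑ i ∈ Finset.range (n + 1), a i • derivLin ^ i

lemma linOp_apply (a : ℕ → F) (n : ℕ) (x : F) :
    linOp a n x = ∑ i ∈ Finset.range (n + 1), a i * (derivLin ^ i : F →ₗ[constants F] F) x := by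
  simp [linOp]

/-- The coefficient `rᵢ` in `f⁽ⁱ⁾ = rᵢ f` for a formal solution `f` of `f′ = β f`. -/
def riccati (β : F) : ℕ → F
  | 0 => 1
  | i + 1 => (riccati β i)′ + β * riccati β i

/-- The coefficients of the right quotient of `dⁱ` by `d - β`. -/
def quotCoeff (β : F) : ℕ → ℕ → F
  | 0, _ => 0
  | i + 1, 0 => (quotCoeff β i 0)′ + riccati β i
  | i + 1, j + 1 => (quotCoeff β i (j + 1))′ + quotCoeff β i j

lemma quotCoeff_eq_zero (β : F) {i j : ℕ} (h : i ≤ j) : quotCoeff β i j = 0 := by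
  induction i generalizing j with
  | zero => rfl
  | succ i ih =>
    obtain ⟨j, rfl⟩ : ∃ k, j = k + 1 := ⟨j - 1, by omega⟩
    simp [quotCoeff, ih (show i ≤ j by omega), ih (show i ≤ j + 1 by omega)]

lemma quotCoeff_succ_self (β : F) (i : ℕ) : quotCoeff β (i + 1) i = 1 := by
  induction i with
  | zero => simp [quotCoeff, riccati]
  | succ i ih => rw [quotCoeff, ih, quotCoeff_eq_zero β le_rfl]; simp

/-- Right division of `dⁱ` by `d - β`. -/
lemma derivLin_pow_eq (β x : F) (i : ℕ) :
    (derivLin ^ i : F →ₗ[constants F] F) x =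
      ∑ j ∈ Finset.range i,
        quotCoeff β i j * (derivLin ^ j : F →ₗ[constants F] F) (firstOrder β x) +
      riccati β i * x := by
  induction i with
  | zero => simp [riccati]
  | succ i ih =>
    have hs : ∀ j, (derivLin ^ (j + 1) : F →ₗ[constants F] F) (firstOrder β x) =
        ((derivLin ^ j : F →ₗ[constants F] F) (firstOrder β x))′ := fun j => by
      rw [pow_succ']; rfl
    have h0 : quotCoeff β i i = 0 := quotCoeff_eq_zero β le_rfl
    have hsum : ∑ j ∈ Finset.range i, (quotCoeff β i (j + 1))′ *
          (derivLin ^ (j + 1) : F →ₗ[constants F] F) (firstOrder β x) +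
        (quotCoeff β i 0)′ * firstOrder β x =
        ∑ j ∈ Finset.range i, (quotCoeff β i j)′ *
          (derivLin ^ j : F →ₗ[constants F] F) (firstOrder β x) := by
      have h := Finset.sum_range_succ' (fun j => (quotCoeff β i j)′ *
          (derivLin ^ j : F →ₗ[constants F] F) (firstOrder β x)) i
      rw [Finset.sum_range_succ, h0] at h
      simpa using h.symm
    rw [pow_succ', Module.End.mul_apply, ih, derivLin_apply, Finset.sum_range_succ']
    simp only [quotCoeff, map_add, map_sum, Derivation.leibniz, smul_eq_mul, add_mul,
      Finset.sum_add_distrib, hs, riccati, pow_zero, Module.End.one_apply]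
    have hx : x′ = firstOrder β x + β * x := by simp
    rw [Finset.sum_congr rfl fun j _ => mul_comm _ (quotCoeff β i j)′, ← hsum]
    simp only [hs]
    rw [hx]
    ring

/-- The coefficients of the right quotient of the operator `linOp a (n + 1)` by `d - β`. -/
def rightQuotient (a : ℕ → F) (β : F) (n j : ℕ) : F :=
  ∑ i ∈ Finset.range (n + 2), a i * quotCoeff β i j

lemma rightQuotient_leading (a : ℕ → F) (β : F) (n : ℕ) : rightQuotient a β n n = a (n + 1) := by
  rw [rightQuotient, Finset.sum_range_succ, quotCoeff_succ_self, Finset.sum_eq_zero]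
  · simp
  · intro i hi
    rw [quotCoeff_eq_zero β (by simp at hi; omega), mul_zero]

lemma linOp_eq_rightQuotient (a : ℕ → F) (β : F) (n : ℕ) (x : F) :
    linOp a (n + 1) x = linOp (rightQuotient a β n) n (firstOrder β x) +
      (∑ i ∈ Finset.range (n + 2), a i * riccati β i) * x := by
  have h : ∀ i ∈ Finset.range (n + 2), (derivLin ^ i : F →ₗ[constants F] F) x =
      ∑ j ∈ Finset.range (n + 1),
        quotCoeff β i j * (derivLin ^ j : F →ₗ[constants F] F) (firstOrder β x) +
      riccati β i * x := by
    intro i hi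
    rw [derivLin_pow_eq β]
    congr 1
    refine Finset.sum_subset (fun j hj => ?_) (fun j _ hj => ?_)
    · simp at hi hj ⊢; omega
    · rw [quotCoeff_eq_zero β (by simpa using hj), zero_mul]
  rw [linOp_apply, linOp_apply, Finset.sum_congr rfl fun i hi => by rw [h i hi]]
  simp only [rightQuotient, mul_add, Finset.sum_add_distrib, Finset.mul_sum, Finset.sum_mul]
  rw [Finset.sum_comm]
  simp only [mul_assoc]

/-- A right factor `d - β` of an operator is the same as a solution `β` of its Riccati
equation. -/
lemma linOp_eq_comp (a : ℕ → F) (β : F) (n : ℕ)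
    (h : ∑ i ∈ Finset.range (n + 2), a i * riccati β i = 0) :
    linOp a (n + 1) = linOp (rightQuotient a β n) n ∘ₗ firstOrder β := by
  ext x
  rw [linOp_eq_rightQuotient a β, h]
  simp

/-- The logarithmic derivative of a solution solves the Riccati equation. -/
lemma riccati_logDeriv (a : ℕ → F) (n : ℕ) {f : F} (hf : f ≠ 0) (h : linOp a n f = 0) :
    ∑ i ∈ Finset.range (n + 1), a i * riccati (f′ / f) i = 0 := by
  have h1 : firstOrder (f′ / f) f = 0 := by simp [hf]
  have h2 : ∀ i, (derivLin ^ i : F →ₗ[constants F] F) f = riccati (f′ / f) i * f := by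
    intro i
    rw [derivLin_pow_eq (f′ / f), h1]
    simp
  rw [linOp_apply] at h
  simp only [h2, ← mul_assoc] at h
  rw [← Finset.sum_mul] at h
  exact (mul_eq_zero.1 h).resolve_right hf

/-- The solutions of `f′ = β f` are the constant multiples of any nonzero one. -/
lemma rank_ker_firstOrder_le (β : F) :
    Module.rank (constants F) (LinearMap.ker (firstOrder β)) ≤ 1 := by
  by_cases hb : LinearMap.ker (firstOrder β) = ⊥
  · rw [hb]; simp
  obtain ⟨f, hf, hf0⟩ := Submodule.exists_mem_ne_zero_of_ne_bot hb
  refine (rank_submodule_le_one_iff' _).2 ⟨f, fun x hx => ?_⟩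
  have hf' : f′ = β * f := by simpa [sub_eq_zero] using hf
  have hx' : x′ = β * x := by simpa [sub_eq_zero] using hx
  have hc : (x / f)′ = 0 := by
    rw [Derivation.leibniz_div, hf', hx']
    simp; ring_nf; simp
  refine Submodule.mem_span_singleton.2 ⟨⟨x / f, hc⟩, ?_⟩
  rw [Subfield.smul_def]
  simp [hf0]

lemma rank_ker_linOp_le (n : ℕ) (a : ℕ → F) (ha : a n ≠ 0) :
    Module.rank (constants F) (LinearMap.ker (linOp a n)) ≤ n := by
  induction n generalizing a with
  | zero =>
    have : LinearMap.ker (linOp a 0) = ⊥ := by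
      rw [LinearMap.ker_eq_bot']
      intro x hx
      simpa [linOp_apply, ha] using hx
    rw [this]; simp
  | succ n ih =>
    by_cases hb : LinearMap.ker (linOp a (n + 1)) = ⊥
    · rw [hb]; simp
    obtain ⟨f, hf, hf0⟩ := Submodule.exists_mem_ne_zero_of_ne_bot hb
    rw [linOp_eq_comp a _ n (riccati_logDeriv a (n + 1) hf0 hf), LinearMap.ker_comp]
    have h0 := LinearMap.lift_rank_comap_le (f := firstOrder (f′ / f))
      (LinearMap.ker (linOp (rightQuotient a (f′ / f) n) n))
    simp only [Cardinal.lift_id] at h0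
    refine h0.trans ?_
    have h1 := rank_ker_firstOrder_le (f′ / f)
    have h2 := ih (rightQuotient a (f′ / f) n) (by rwa [rightQuotient_leading])
    push_cast
    exact add_le_add h2 h1

lemma finite_ker_linOp (n : ℕ) (a : ℕ → F) (ha : a n ≠ 0) :
    FiniteDimensional (constants F) (LinearMap.ker (linOp a n)) := by
  rw [FiniteDimensional, ← Module.rank_lt_aleph0_iff]
  exact (rank_ker_linOp_le n a ha).trans_lt (Cardinal.natCast_lt_aleph0)

/-- If an operator of order `n + 1` with right factor `d - β` has a full solution space, then so
do both factors: `f′ = β f` has a nonzero solution, and every solution of the left factor comes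
from a solution of the operator. -/
lemma full_of_comp (n : ℕ) (a : ℕ → F) (ha : a (n + 1) ≠ 0) (β : F)
    (h : ∑ i ∈ Finset.range (n + 2), a i * riccati β i = 0)
    (hfull : Module.finrank (constants F) (LinearMap.ker (linOp a (n + 1))) = n + 1) :
    (∃ f : F, f ≠ 0 ∧ f′ = β * f ∧ linOp a (n + 1) f = 0) ∧
    Module.finrank (constants F) (LinearMap.ker (linOp (rightQuotient a β n) n)) = n ∧
    ∀ w, linOp (rightQuotient a β n) n w = 0 → ∃ v, linOp a (n + 1) v = 0 ∧ firstOrder β v = w := by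
  have hq : rightQuotient a β n n ≠ 0 := by rwa [rightQuotient_leading]
  have hcomp := linOp_eq_comp a β n h
  have := finite_ker_linOp n _ hq
  have := finite_ker_linOp (n + 1) a ha
  have hle : Module.finrank (constants F) (LinearMap.ker (linOp (rightQuotient a β n) n)) ≤ n :=
    Module.finrank_le_of_rank_le (rank_ker_linOp_le n _ hq)
  let ψ : LinearMap.ker (linOp a (n + 1)) →ₗ[constants F]
      LinearMap.ker (linOp (rightQuotient a β n) n) :=
    (firstOrder β).restrict fun x hx => by
      rw [LinearMap.mem_ker, hcomp] at hx
      exact hx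
  have hψ : ∀ x, (ψ x : F) = firstOrder β x := fun x => rfl
  have hker : Module.finrank (constants F) (LinearMap.ker ψ) ≤ 1 := by
    refine Module.finrank_le_of_rank_le ((?_ : _ ≤ _).trans (rank_ker_firstOrder_le β))
    let i : LinearMap.ker ψ →ₗ[constants F] LinearMap.ker (firstOrder β) :=
      ((LinearMap.ker (linOp a (n + 1))).subtype ∘ₗ (LinearMap.ker ψ).subtype).codRestrict _
        fun x => by
          have : ψ x = 0 := x.2
          have h2 := hψ x
          rw [this] at h2
          exact h2.symm
    refine LinearMap.rank_le_of_injective i ?_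
    refine fun x y hxy => Subtype.ext (Subtype.ext ?_)
    exact congrArg (Subtype.val (p := (· ∈ LinearMap.ker (firstOrder β)))) hxy
  have hsum := LinearMap.finrank_range_add_finrank_ker ψ
  have hrange := Submodule.finrank_le (LinearMap.range ψ)
  have hfin : Module.finrank (constants F) (LinearMap.ker (linOp (rightQuotient a β n) n)) = n := by
    omega
  have htop : LinearMap.range ψ = ⊤ := Submodule.eq_top_of_finrank_eq (by omega)
  refine ⟨?_, hfin, fun w hw => ?_⟩
  · have hpos : 0 < Module.finrank (constants F) (LinearMap.ker ψ) := by omega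
    have hne : LinearMap.ker ψ ≠ ⊥ := by
      intro hb; rw [hb] at hpos; simp at hpos
    obtain ⟨f, hf, hf0⟩ := Submodule.exists_mem_ne_zero_of_ne_bot hne
    refine ⟨f, by simpa using hf0, ?_, f.2⟩
    have h2 := hψ f
    rw [LinearMap.mem_ker.1 hf] at h2
    simpa [sub_eq_zero] using h2.symm
  · obtain ⟨v, hv⟩ := LinearMap.range_eq_top.1 htop ⟨w, hw⟩
    exact ⟨v, v.2, by rw [← hψ, hv]⟩

end Operators

/-! ### Specialization at a special transcendental element -/

section Specialization

open Polynomial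

variable {K F : Type*} [Field K] [Field F] [Algebra K F]

lemma aeval_ne_zero {A : Type*} [Field A] [Algebra A F] {y : F} (hy : Transcendental A y)
    {q : A[X]} (hq : q ≠ 0) : aeval y q ≠ 0 :=
  fun h => hq ((transcendental_iff.1 hy) _ h)

/-- A rational function of `y` is a quotient of coprime polynomials. -/
lemma exists_coprime_div {A : Type*} [Field A] [Algebra A F] {y : F} (hy : Transcendental A y)
    (p q : A[X]) : ∃ p' q' : A[X], IsCoprime p' q' ∧ q' ≠ 0 ∧
      aeval y p / aeval y q = aeval y p' / aeval y q' := by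
  classical
  by_cases hq : q = 0
  · exact ⟨0, 1, isCoprime_zero_left.2 isUnit_one, one_ne_zero, by simp [hq]⟩
  have hg : EuclideanDomain.gcd p q ≠ 0 := fun h => hq (EuclideanDomain.gcd_eq_zero_iff.1 h).2
  have hb := EuclideanDomain.gcd_eq_gcd_ab p q
  obtain ⟨p', hp'⟩ := EuclideanDomain.gcd_dvd_left p q
  obtain ⟨q', hq'⟩ := EuclideanDomain.gcd_dvd_right p q
  generalize EuclideanDomain.gcd p q = g at *
  generalize EuclideanDomain.gcdA p q = u at *
  generalize EuclideanDomain.gcdB p q = v at *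
  subst hp' hq'
  refine ⟨p', q', ⟨u, v, mul_left_cancel₀ hg ?_⟩, right_ne_zero_of_mul hq, ?_⟩
  · linear_combination -hb
  · rw [map_mul, map_mul]
    exact mul_div_mul_left _ _ (aeval_ne_zero hy hg)

/-- If `y` is transcendental over `A`, then `A` is closed under radicals in `A(y)`. -/
lemma mem_of_pow_mem {A : IntermediateField K F} {y : F} (hy : Transcendental A y) (p q : A[X])
    {k : ℕ} (hk : k ≠ 0) (h : (aeval y p / aeval y q) ^ k ∈ A) : aeval y p / aeval y q ∈ A := by
  obtain ⟨p, q, hpq, hq, he⟩ := exists_coprime_div hy p q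
  rw [he] at h ⊢
  -- If `p / q` is in lowest terms and `pᵏ = c qᵏ`, then `q` is a unit and `p` is constant.
  have hpow : p ^ k = C (⟨_, h⟩ : A) * q ^ k := by
    refine transcendental_iff_injective.1 hy ?_
    have h0 := aeval_ne_zero hy hq
    simp only [map_mul, map_pow, aeval_C, IntermediateField.algebraMap_apply]
    rw [← mul_pow, div_mul_cancel₀ _ h0]
  have hqu : IsUnit q := by
    have h1 : q ∣ p ^ k := by
      rw [hpow]; exact Dvd.dvd.mul_left (dvd_pow_self q hk) _
    exact (hpq.pow_left).isUnit_of_dvd' h1 dvd_rfl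
  obtain ⟨b, hb, rfl⟩ := Polynomial.isUnit_iff.1 hqu
  have hdeg : p.natDegree = 0 := by
    have h2 : (p ^ k).natDegree = 0 := by
      rw [hpow, ← C_pow, ← C_mul, natDegree_C]
    rw [natDegree_pow] at h2
    exact (mul_eq_zero.1 h2).resolve_left hk
  rw [eq_C_of_natDegree_eq_zero hdeg, aeval_C, aeval_C]
  exact div_mem (SetLike.coe_mem _) (SetLike.coe_mem _)

/-- `SpecializesTo A y x a` says that the element `x = p(y) / q(y)` of the local ring
of `A(y)` at `y = 0` (so `q(0) ≠ 0`) has the value `a` at `y = 0`. -/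
def SpecializesTo (A : IntermediateField K F) (y x a : F) : Prop :=
  ∃ p q : A[X], q.eval 0 ≠ 0 ∧ x * aeval y q = aeval y p ∧
    ((p.eval 0 : A) : F) = a * ((q.eval 0 : A) : F)

namespace SpecializesTo

variable {A : IntermediateField K F} {y x a z b : F}

lemma mem (h : SpecializesTo A y x a) : a ∈ A := by
  obtain ⟨p, q, hq, -, h⟩ := h
  have h0 : ((q.eval 0 : A) : F) ≠ 0 := by simpa using hq
  rw [← div_eq_iff h0] at h
  rw [← h]
  exact div_mem (SetLike.coe_mem _) (SetLike.coe_mem _)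

lemma of_mem (h : a ∈ A) : SpecializesTo A y a a :=
  ⟨C ⟨a, h⟩, 1, by simp, by simp, by simp⟩

lemma add (h : SpecializesTo A y x a) (h' : SpecializesTo A y z b) :
    SpecializesTo A y (x + z) (a + b) := by
  obtain ⟨p, q, hq, e, f⟩ := h
  obtain ⟨p', q', hq', e', f'⟩ := h'
  refine ⟨p * q' + p' * q, q * q', by simp [hq, hq'], ?_, ?_⟩
  · simp only [map_add, map_mul, ← e, ← e']; ring
  · simp only [eval_add, eval_mul, IntermediateField.coe_add, IntermediateField.coe_mul, f, f']
    ring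

lemma mul (h : SpecializesTo A y x a) (h' : SpecializesTo A y z b) :
    SpecializesTo A y (x * z) (a * b) := by
  obtain ⟨p, q, hq, e, f⟩ := h
  obtain ⟨p', q', hq', e', f'⟩ := h'
  refine ⟨p * p', q * q', by simp [hq, hq'], ?_, ?_⟩
  · simp only [map_mul, ← e, ← e']; ring
  · simp only [eval_mul, IntermediateField.coe_mul, f, f']
    ring

lemma pow (h : SpecializesTo A y x a) (n : ℕ) : SpecializesTo A y (x ^ n) (a ^ n) := by
  induction n with
  | zero => simpa using of_mem (one_mem A)
  | succ n ih => rw [pow_succ, pow_succ]; exact ih.mul h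

lemma sum {s : Finset ℕ} {f g : ℕ → F} (h : ∀ i ∈ s, SpecializesTo A y (f i) (g i)) :
    SpecializesTo A y (∑ i ∈ s, f i) (∑ i ∈ s, g i) := by
  classical
  induction s using Finset.induction_on with
  | empty => simpa using of_mem (zero_mem A)
  | insert i s hi ih =>
    rw [Finset.sum_insert hi, Finset.sum_insert hi]
    exact (h i (by simp)).add (ih fun j hj => h j (by simp [hj]))

lemma eq_zero (hy : Transcendental A y) (h : SpecializesTo A y 0 a) : a = 0 := by
  obtain ⟨p, q, hq, e, f⟩ := h
  have hp : p = 0 := transcendental_iff.1 hy _ (by rw [← e, zero_mul])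
  have h0 : ((q.eval 0 : A) : F) ≠ 0 := by simpa using hq
  simpa [hp, h0] using f.symm

end SpecializesTo

variable [Differential F]

lemma isDifferential_diffAdjoin (A : IntermediateField K F) (y : F) :
    IsDifferential (diffAdjoin A y) := by
  intro x hx
  simp only [diffAdjoin, IntermediateField.mem_sInf] at hx ⊢
  exact fun B hB => hB.1 x (hx B hB)

lemma le_diffAdjoin (A : IntermediateField K F) (y : F) : A ≤ diffAdjoin A y :=
  le_sInf fun _ hB => hB.2.1

lemma mem_diffAdjoin (A : IntermediateField K F) (y : F) : y ∈ diffAdjoin A y := by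
  simp only [diffAdjoin, IntermediateField.mem_sInf]
  exact fun B hB => hB.2.2

lemma diffAdjoin_le {A B : IntermediateField K F} {y : F} (hB : IsDifferential B) (hAB : A ≤ B)
    (hy : y ∈ B) : diffAdjoin A y ≤ B :=
  sInf_le ⟨hB, hAB, hy⟩

/-- A field generated over a differential field by elements whose derivatives it contains is a
differential field. -/
lemma deriv_mem_adjoin {A : Type*} [Field A] [Algebra A F] {s : Set F}
    (hA : ∀ x : A, (algebraMap A F x)′ ∈ IntermediateField.adjoin A s)
    (hs : ∀ x ∈ s, x′ ∈ IntermediateField.adjoin A s) :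
    ∀ x ∈ IntermediateField.adjoin A s, x′ ∈ IntermediateField.adjoin A s := by
  intro x hx
  induction hx using IntermediateField.adjoin_induction with
  | mem x hx => exact hs x hx
  | algebraMap x => exact hA x
  | add x y hx hy h1 h2 => rw [map_add]; exact add_mem h1 h2
  | inv x hx h =>
    rw [Derivation.leibniz_inv]
    exact mul_mem (neg_mem (pow_mem (inv_mem hx) _)) h
  | mul x y hx hy h1 h2 =>
    rw [Derivation.leibniz]
    exact add_mem (mul_mem hx h2) (mul_mem hy h1)

/-- Every element of `A⟨y⟩` is a rational function of `y`, provided that `y′` is one. -/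
lemma exists_div_of_mem_diffAdjoin {A : IntermediateField K F} (hA : IsDifferential A) {y x : F}
    (hy : y′ ∈ IntermediateField.adjoin A {y}) (hx : x ∈ diffAdjoin A y) :
    ∃ p q : A[X], x = aeval y p / aeval y q := by
  rw [← IntermediateField.mem_adjoin_simple_iff]
  have h : diffAdjoin A y ≤ (IntermediateField.adjoin A {y}).restrictScalars K := by
    refine diffAdjoin_le (fun z hz => ?_) (fun z hz => ?_) ?_
    · have h1 : ∀ w : A, (algebraMap A F w)′ ∈ IntermediateField.adjoin A {y} := fun w =>
        (IntermediateField.adjoin A {y}).algebraMap_mem (⟨(w : F)′, hA _ w.2⟩ : A)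
      have h2 : ∀ w ∈ ({y} : Set F), w′ ∈ IntermediateField.adjoin A {y} := fun w hw => by
        rwa [Set.mem_singleton_iff.1 hw]
      exact deriv_mem_adjoin h1 h2 z hz
    · exact IntermediateField.algebraMap_mem (IntermediateField.adjoin A {y}) (⟨z, hz⟩ : A)
    · exact IntermediateField.mem_adjoin_simple_self A y
  exact h hx

/-- If `y′ = y P(y) / Q(y)` with `Q(0) ≠ 0`, then the derivation preserves the local ring at
`y = 0` and its maximal ideal, so that it commutes with evaluation at `y = 0`. -/
lemma SpecializesTo.deriv {A : IntermediateField K F} {y x a : F} (hA : IsDifferential A)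
    {P Q : A[X]} (hQ : Q.eval 0 ≠ 0)
    (hyQ : y′ * aeval y Q = y * aeval y P) (h : SpecializesTo A y x a) :
    SpecializesTo A y x′ a′ := by
  -- `d` maps `A[y]` into `Q(y)⁻¹ A[y]`, with the expected value at `y = 0`.
  have key : ∀ p : A[X], ∃ r : A[X], aeval y r = aeval y Q * (aeval y p)′ ∧
      ((r.eval 0 : A) : F) = ((Q.eval 0 : A) : F) * ((p.eval 0 : A) : F)′ := by
    intro p
    induction p using Polynomial.induction_on with
    | C c =>
      refine ⟨Q * C ⟨(c : F)′, hA _ c.2⟩, ?_, ?_⟩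
      · simp
      · simp
    | add p q hp hq =>
      obtain ⟨r, h1, h2⟩ := hp
      obtain ⟨s, h3, h4⟩ := hq
      refine ⟨r + s, ?_, ?_⟩
      · simp only [map_add, h1, h3]; ring
      · simp only [eval_add, IntermediateField.coe_add, h2, h4, map_add]; ring
    | monomial n c ih =>
      obtain ⟨r, h1, -⟩ := ih
      refine ⟨r * X + X * P * (C c * X ^ n), ?_, ?_⟩
      · have hX : C c * X ^ (n + 1) = C c * X ^ n * X := by rw [pow_succ, mul_assoc]
        rw [hX]
        generalize C c * X ^ n = s at *
        simp only [map_add, map_mul, h1, aeval_X, Derivation.leibniz, smul_eq_mul]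
        linear_combination -(aeval y s) * hyQ
      · simp
  obtain ⟨p, q, hq, e, f⟩ := h
  obtain ⟨r, h1, h2⟩ := key p
  obtain ⟨s, h3, h4⟩ := key q
  have e' := congrArg (fun z => (z)′) e
  have f' := congrArg (fun z => (z)′) f
  simp only [Derivation.leibniz, smul_eq_mul] at e' f'
  refine ⟨r * q - p * s, Q * q ^ 2, by simp [hQ, hq], ?_, ?_⟩
  · simp only [map_mul, map_sub, map_pow, h1, h3]
    linear_combination aeval y Q * aeval y q * e' - aeval y Q * (aeval y q)′ * e
  · simp only [eval_sub, eval_mul, eval_pow, AddSubgroupClass.coe_sub, IntermediateField.coe_mul,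
      IntermediateField.coe_pow, h2, h4]
    linear_combination ((Q.eval 0 : A) : F) * ((q.eval 0 : A) : F) * f' -
      ((Q.eval 0 : A) : F) * ((q.eval 0 : A) : F)′ * f

/-- The recursion for `γⁱ rᵢ`, where `rᵢ` is the `i`-th Riccati polynomial of `β = γ⁻¹`. It involves
no `β`, so it can be evaluated where `γ` vanishes. -/
lemma pow_mul_riccati_succ {β γ : F} (h : γ * β = 1) (i : ℕ) :
    γ ^ (i + 1) * riccati β (i + 1) =
      γ ^ i * riccati β i + γ * (γ ^ i * riccati β i)′ - i * γ′ * (γ ^ i * riccati β i) := by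
  have hγ : γ ≠ 0 := left_ne_zero_of_mul_eq_one h
  have hβ : β = γ⁻¹ := eq_inv_of_mul_eq_one_right h
  rw [riccati, Derivation.leibniz, Derivation.leibniz_pow, hβ]
  simp only [smul_eq_mul, nsmul_eq_mul]
  rcases i with _ | i
  · simp [hγ, riccati]
  · simp only [Nat.add_sub_cancel]
    field_simp
    ring

lemma IsSpecialTranscendental.deriv_mem_adjoin {A : IntermediateField K F} {y : F}
    (h : IsSpecialTranscendental A y) : y′ ∈ IntermediateField.adjoin A {y} := by
  obtain ⟨-, P, Q, -, -, h⟩ := h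
  rw [IntermediateField.mem_adjoin_simple_iff]
  exact ⟨_, _, h⟩

/-- A solution `β ∈ A⟨y⟩` of a Riccati equation over `A` has no pole at `y = 0`, and its value at
`y = 0` is a solution in `A`. -/
lemma exists_riccati_of_special {A : IntermediateField K F} (hA : IsDifferential A) {y : F}
    (hy : IsSpecialTranscendental A y) {n : ℕ} {a : ℕ → F} (ha : ∀ i, a i ∈ A) (han : a n ≠ 0)
    {β : F} (hβ : β ∈ diffAdjoin A y)
    (h : ∑ i ∈ Finset.range (n + 1), a i * riccati β i = 0) :
    ∃ b ∈ A, ∑ i ∈ Finset.range (n + 1), a i * riccati b i = 0 := by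
  obtain ⟨p, q, he⟩ := exists_div_of_mem_diffAdjoin hA hy.deriv_mem_adjoin hβ
  obtain ⟨hyt, P, Q, hQ0, hPQ, hyd⟩ := hy
  have hQy := aeval_ne_zero hyt hQ0
  have hyQ : y′ * aeval y Q = y * aeval y P := by
    rw [hyd, div_mul_cancel₀ _ hQy, map_mul, aeval_X]
  have hQ : Q.eval 0 ≠ 0 := by
    obtain ⟨u, v, huv⟩ := hPQ
    intro h0
    have := congrArg (eval 0) huv
    simp [h0] at this
  obtain ⟨p, q, hpq, hq0, he'⟩ := exists_coprime_div hyt p q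
  rw [he'] at he
  have hqy := aeval_ne_zero hyt hq0
  by_cases hq : q.eval 0 = 0
  · -- A pole of `β` is impossible: `γ = β⁻¹` vanishes at `y = 0`, and the Riccati equation
    -- multiplied by `γⁿ` has the value `aₙ` there.
    exfalso
    have hp : p.eval 0 ≠ 0 := by
      obtain ⟨u, v, huv⟩ := hpq
      intro h0
      have := congrArg (eval 0) huv
      simp [h0, hq] at this
    have hpy : aeval y p ≠ 0 := aeval_ne_zero hyt (by rintro rfl; simp at hp)
    set γ : F := aeval y q / aeval y p with hγ
    have hγβ : γ * β = 1 := by rw [he, hγ]; field_simp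
    have hγ0 : SpecializesTo A y γ 0 :=
      ⟨q, p, hp, by rw [hγ, div_mul_cancel₀ _ hpy], by simp [hq]⟩
    have hγd : SpecializesTo A y γ′ 0 := by simpa using hγ0.deriv hA hQ hyQ
    have hS : ∀ i, SpecializesTo A y (γ ^ i * riccati β i) 1 := by
      intro i
      induction i with
      | zero => simpa [riccati] using SpecializesTo.of_mem (one_mem A)
      | succ i ih =>
        have h1 := (ih.add (hγ0.mul (ih.deriv hA hQ hyQ))).add
          (((SpecializesTo.of_mem (neg_mem (natCast_mem A i))).mul hγd).mul ih)
        rw [pow_mul_riccati_succ hγβ]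
        convert! h1 using 1
        · ring
        · simp
    have hsum : SpecializesTo A y (∑ i ∈ Finset.range (n + 1), a i * γ ^ (n - i) *
        (γ ^ i * riccati β i)) (∑ i ∈ Finset.range (n + 1), a i * 0 ^ (n - i) * 1) :=
      SpecializesTo.sum fun i _ => ((SpecializesTo.of_mem (ha i)).mul (hγ0.pow _)).mul (hS i)
    have hz : ∑ i ∈ Finset.range (n + 1), a i * γ ^ (n - i) * (γ ^ i * riccati β i) = 0 := by
      rw [← mul_zero (γ ^ n), ← h, Finset.mul_sum]
      refine Finset.sum_congr rfl fun i hi => ?_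
      have : γ ^ n = γ ^ (n - i) * γ ^ i := by
        rw [← pow_add]; congr 1; simp at hi; omega
      rw [this]; ring
    rw [hz] at hsum
    have := hsum.eq_zero hyt
    rw [Finset.sum_range_succ, Finset.sum_eq_zero] at this
    · simp at this; exact han this
    · intro i hi
      have : n - i ≠ 0 := by simp at hi; omega
      simp [this]
  · obtain ⟨b, hb⟩ : ∃ b, SpecializesTo A y β b := by
      refine ⟨((p.eval 0 : A) : F) / ((q.eval 0 : A) : F), p, q, hq, ?_, ?_⟩
      · rw [he, div_mul_cancel₀ _ hqy]
      · rw [div_mul_cancel₀]; simpa using hq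
    have hr : ∀ i, SpecializesTo A y (riccati β i) (riccati b i) := by
      intro i
      induction i with
      | zero => exact SpecializesTo.of_mem (one_mem A)
      | succ i ih => exact (ih.deriv hA hQ hyQ).add (hb.mul ih)
    have hsum := SpecializesTo.sum (s := Finset.range (n + 1)) fun i _ =>
      (SpecializesTo.of_mem (ha i)).mul (hr i)
    rw [h] at hsum
    exact ⟨b, hb.mem, hsum.eq_zero hyt⟩

end Specialization

/-! ### Algebraic independence of exponentials -/

section Exponentials

open Differential

/-- A finitely generated subgroup that is torsion-free modulo `N` has a basis modulo `N`. -/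
lemma exists_basis_modulo {M : Type*} [AddCommGroup M] (N : Submodule ℤ M) {s : Set M}
    (hs : s.Finite) (h : ∀ x ∈ Submodule.span ℤ s, ∀ k : ℤ, k ≠ 0 → k • x ∈ N → x ∈ N) :
    ∃ (r : ℕ) (g : Fin r → M), (∀ j, g j ∈ Submodule.span ℤ s) ∧
      (∀ x ∈ s, ∃ e : Fin r → ℤ, x - ∑ j, e j • g j ∈ N) ∧
      ∀ e : Fin r → ℤ, ∑ j, e j • g j ∈ N → e = 0 := by
  let Q := (Submodule.span ℤ s).map N.mkQ
  have : Module.Finite ℤ Q :=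
    Module.Finite.iff_fg.2 ((Submodule.fg_span hs).map _)
  have : Module.IsTorsionFree ℤ Q := by
    refine Module.IsTorsionFree.of_smul_eq_zero fun k x hkx => ?_
    obtain ⟨_, x, hx, rfl⟩ := x
    rw [or_iff_not_imp_left]
    intro hk
    have h1 : N.mkQ (k • x) = 0 := by
      rw [map_smul]; exact congrArg (Subtype.val (p := (· ∈ Q))) hkx
    have h2 := h x hx k hk ((Submodule.Quotient.mk_eq_zero N).1 h1)
    exact Subtype.ext ((Submodule.Quotient.mk_eq_zero N).2 h2)
  obtain ⟨r, b⟩ := Module.basisOfFiniteTypeTorsionFree' (R := ℤ) (M := Q)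
  have hb : ∀ j, ∃ g ∈ Submodule.span ℤ s, N.mkQ g = b j := fun j => (b j).2
  choose g hg hgb using hb
  have hsum : ∀ e : Fin r → ℤ, N.mkQ (∑ j, e j • g j) = ((∑ j, e j • b j : Q) : M ⧸ N) := by
    intro e
    simp [hgb, -Submodule.mkQ_apply]
  refine ⟨r, g, hg, fun x hx => ?_, fun e he => ?_⟩
  · refine ⟨b.repr ⟨N.mkQ x, x, Submodule.subset_span hx, rfl⟩, ?_⟩
    rw [← Submodule.Quotient.mk_eq_zero, ← Submodule.mkQ_apply, map_sub, hsum, b.sum_repr,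
      sub_self]
  · have h1 : ∑ j, e j • b j = 0 := by
      apply Subtype.ext
      rw [← hsum]
      exact (Submodule.Quotient.mk_eq_zero N).2 he
    funext j
    exact Fintype.linearIndependent_iff.1 b.linearIndependent e h1 j

variable {K F : Type*} [Field K] [Field F] [Algebra K F]

/-- The group of units of an intermediate field, inside the group of units of `F`. -/
def fieldUnits (A : IntermediateField K F) : Subgroup Fˣ where
  carrier := {u | (u : F) ∈ A}
  one_mem' := by simp
  mul_mem' h h' := by simpa using mul_mem h h'
  inv_mem' {u} h := by
    have h' : (u : F) ∈ A := h
    simpa using inv_mem h'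

@[simp] lemma mem_fieldUnits {A : IntermediateField K F} {u : Fˣ} :
    u ∈ fieldUnits A ↔ (u : F) ∈ A := Iff.rfl

variable [Differential F]

/-- The group of nonzero exponentials of integrals over `A`. -/
def expUnits (A : IntermediateField K F) : Subgroup Fˣ where
  carrier := {u | logDeriv (u : F) ∈ A}
  one_mem' := by simp
  mul_mem' h h' := by
    simp only [Set.mem_ofPred_eq, Units.val_mul] at *
    rw [logDeriv_mul _ _ (Units.ne_zero _) (Units.ne_zero _)]
    exact add_mem h h'
  inv_mem' {u} h := by
    have h1 := logDeriv_div 1 (u : F) one_ne_zero u.ne_zero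
    simp only [Set.mem_ofPred_eq, Units.val_inv_eq_inv_val] at *
    rw [inv_eq_one_div, h1, logDeriv_one, zero_sub]
    exact neg_mem h

@[simp] lemma mem_expUnits {A : IntermediateField K F} {u : Fˣ} :
    u ∈ expUnits A ↔ logDeriv (u : F) ∈ A := Iff.rfl

variable (K) in
lemma mem_bot_of_deriv_eq_zero [ContainConstants K F] {x : F} (h : x′ = 0) :
    x ∈ (⊥ : IntermediateField K F) :=
  IntermediateField.mem_bot.2 (mem_range_of_deriv_eq_zero K h)

variable [Differential K] [DifferentialAlgebra K F]

lemma isDifferential_bot : IsDifferential (⊥ : IntermediateField K F) := by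
  intro x hx
  obtain ⟨k, rfl⟩ := IntermediateField.mem_bot.1 hx
  rw [deriv_algebraMap]
  exact IntermediateField.mem_bot.2 ⟨_, rfl⟩

variable [ContainConstants K F]

/-- Exponentials of integrals over `K`, no two of which are proportional over `K`, are linearly
independent over `K`. -/
lemma linearIndependent_of_expUnits {ι : Type*} (h : ι → Fˣ)
    (hd : ∀ i, h i ∈ expUnits (⊥ : IntermediateField K F))
    (hr : ∀ i j, h i * (h j)⁻¹ ∈ fieldUnits (⊥ : IntermediateField K F) → i = j) :
    LinearIndependent K fun i => (h i : F) := by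
  classical
  choose b hb using fun i => IntermediateField.mem_bot.1 (hd i)
  have hb' : ∀ i, (h i : F)′ = algebraMap K F (b i) * h i := fun i => by
    rw [hb, Differential.logDeriv, div_mul_cancel₀ _ (h i).ne_zero]
  rw [linearIndependent_iff']
  intro s
  induction s using Finset.induction_on with
  | empty => simp
  | insert o s ho ih =>
    intro c hc
    suffices hco : c o = 0 by
      intro i hi
      rw [Finset.sum_insert ho, hco, zero_smul, zero_add] at hc
      rcases Finset.mem_insert.1 hi with rfl | hi
      · exact hco
      · exact ih c hc i hi
    by_contra hco
    -- Applying `d - γ`, where `γ` is the logarithmic derivative of the term of index `o`,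
    -- shortens the relation.
    have hterm : ∀ i, (c i • (h i : F))′ = algebraMap K F ((c i)′ + c i * b i) * h i := by
      intro i
      rw [Algebra.smul_def, Derivation.leibniz, hb', deriv_algebraMap]
      simp only [smul_eq_mul, map_add, map_mul]
      ring
    set γ : K := (c o)′ / c o + b o with hγ
    have hγo : (c o • (h o : F))′ = algebraMap K F γ * (c o • (h o : F)) := by
      rw [hterm, Algebra.smul_def, ← mul_assoc, ← map_mul, hγ]
      congr 2
      field_simp
    have hrel : ∑ i ∈ s, ((c i)′ + c i * b i - γ * c i) • (h i : F) = 0 := by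
      have h1 : (∑ i ∈ insert o s, c i • (h i : F))′ -
          algebraMap K F γ * ∑ i ∈ insert o s, c i • (h i : F) = 0 := by
        rw [hc]; simp
      rw [Finset.sum_insert ho, map_add, mul_add, hγo, map_sum, Finset.mul_sum,
        add_sub_add_left_eq_sub, ← Finset.sum_sub_distrib] at h1
      rw [← h1]
      refine Finset.sum_congr rfl fun i _ => ?_
      rw [hterm]
      simp only [Algebra.smul_def, map_sub, map_add, map_mul]
      ring
    have hzero : ∀ i ∈ s, c i = 0 := by
      intro i hi
      by_contra hci
      have hi0 := ih _ hrel i hi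
      have hγi : (c i • (h i : F))′ = algebraMap K F γ * (c i • (h i : F)) := by
        rw [hterm, Algebra.smul_def, ← mul_assoc, ← map_mul, sub_eq_zero.1 hi0]
      have hne : c o • (h o : F) ≠ 0 := smul_ne_zero hco (h o).ne_zero
      have hconst : (c i • (h i : F) / (c o • (h o : F)))′ = 0 := by
        rw [Derivation.leibniz_div, hγi, hγo]
        simp only [smul_eq_mul]
        rw [mul_left_comm, mul_left_comm (c i • (h i : F)), mul_comm (c o • (h o : F)), sub_self,
          mul_zero]
      have hmem := mem_bot_of_deriv_eq_zero K hconst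
      have hio : i = o := by
        refine hr i o ?_
        rw [mem_fieldUnits]
        have h2 : ((h i * (h o)⁻¹ : Fˣ) : F) = algebraMap K F (c o / c i) *
            (c i • (h i : F) / (c o • (h o : F))) := by
          have h3 : algebraMap K F (c i) ≠ 0 := by simpa using hci
          have h4 : algebraMap K F (c o) ≠ 0 := by simpa using hco
          have h5 := (h o).ne_zero
          rw [Algebra.smul_def, Algebra.smul_def, map_div₀, Units.val_mul,
            Units.val_inv_eq_inv_val]
          field_simp
        rw [h2]
        exact mul_mem (IntermediateField.algebraMap_mem _ _) hmem
      exact ho (hio ▸ hi)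
    rw [Finset.sum_insert ho, Finset.sum_eq_zero fun i hi => by rw [hzero i hi, zero_smul],
      add_zero] at hc
    exact (smul_ne_zero hco (h o).ne_zero) hc

/-- Exponentials of integrals over `K` that are multiplicatively independent modulo `Kˣ` are
algebraically independent over `K`. -/
lemma algebraicIndependent_of_expUnits {r : ℕ} (g : Fin r → Fˣ)
    (hd : ∀ i, g i ∈ expUnits (⊥ : IntermediateField K F))
    (hg : ∀ e : Fin r → ℤ, ∏ j, g j ^ e j ∈ fieldUnits (⊥ : IntermediateField K F) → e = 0) :
    AlgebraicIndependent K fun j => (g j : F) := by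
  have hlin : LinearIndependent K fun s : Fin r →₀ ℕ => ((∏ j, g j ^ s j : Fˣ) : F) := by
    refine linearIndependent_of_expUnits _ (fun s => ?_) fun s t hst => ?_
    · exact Subgroup.prod_mem _ fun j _ => Subgroup.pow_mem _ (hd j) _
    · have h1 := hg (fun j => (s j : ℤ) - t j) (by
        simpa only [zpow_sub, zpow_natCast, Finset.prod_mul_distrib, Finset.prod_inv_distrib]
          using hst)
      ext j
      have := congrFun h1 j
      simp only [Pi.zero_apply] at this
      omega
  rw [algebraicIndependent_iff]
  intro p hp
  rw [MvPolynomial.aeval_def, MvPolynomial.eval₂_eq'] at hp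
  ext d
  by_cases hd : d ∈ p.support
  · refine linearIndependent_iff'.1 hlin p.support (fun d => p.coeff d) ?_ d hd
    simpa [Algebra.smul_def] using hp
  · simpa using hd

end Exponentials

/-! ### Towers of differential fields -/

section Towers

variable {K F : Type*} [Field K] [Field F] [Differential F] [Algebra K F]

/-- `B = A⟨y⟩` for one allowed element `y`. -/
def AdjoinStep (Allowed : IntermediateField K F → F → Prop) (A B : IntermediateField K F) : Prop :=
  ∃ y : F, Allowed A y ∧ B = diffAdjoin A y

open Relation

lemma reflTransGen_of_hasChain {Allowed : IntermediateField K F → F → Prop}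
    {E : IntermediateField K F} (h : HasChain Allowed E) :
    ReflTransGen (AdjoinStep Allowed) ⊥ E := by
  obtain ⟨m, c, h0, hm, -, hstep⟩ := h
  rw [← hm]
  induction Fin.last m using Fin.induction with
  | zero => rw [h0]
  | succ i ih => exact ih.tail (hstep i)

lemma hasChain_of_reflTransGen {Allowed : IntermediateField K F → F → Prop}
    (hbot : IsDifferential (⊥ : IntermediateField K F)) {E : IntermediateField K F}
    (h : ReflTransGen (AdjoinStep Allowed) ⊥ E) : HasChain Allowed E := by
  induction h with
  | refl => exact ⟨0, fun _ => ⊥, rfl, rfl, fun _ => hbot, fun i => i.elim0⟩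
  | @tail B E _ hBE ih =>
    obtain ⟨m, c, h0, hm, hd, hstep⟩ := ih
    obtain ⟨y, hy, rfl⟩ := hBE
    refine ⟨m + 1, Fin.snoc c (diffAdjoin B y), ?_, by simp, fun i => ?_, fun i => ?_⟩
    · rw [← Fin.castSucc_zero, Fin.snoc_castSucc, h0]
    · induction i using Fin.lastCases with
      | last => simpa using isDifferential_diffAdjoin B y
      | cast i => simpa using hd i
    · induction i using Fin.lastCases with
      | last => exact ⟨y, by simpa [hm] using hy, by simp [hm]⟩
      | cast i =>
        obtain ⟨z, hz, hz'⟩ := hstep i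
        refine ⟨z, by simpa using hz, ?_⟩
        rw [Fin.snoc_castSucc, ← Fin.castSucc_succ, Fin.snoc_castSucc, hz']

lemma isDifferential_of_reflTransGen {Allowed : IntermediateField K F → F → Prop}
    {A B : IntermediateField K F} (hA : IsDifferential A)
    (h : ReflTransGen (AdjoinStep Allowed) A B) : IsDifferential B := by
  cases h with
  | refl => exact hA
  | tail _ h =>
    obtain ⟨y, -, rfl⟩ := h
    exact isDifferential_diffAdjoin _ y

lemma le_of_reflTransGen {Allowed : IntermediateField K F → F → Prop}
    {A B : IntermediateField K F} (h : ReflTransGen (AdjoinStep Allowed) A B) : A ≤ B := by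
  induction h with
  | refl => exact le_rfl
  | tail _ h ih =>
    obtain ⟨y, -, rfl⟩ := h
    exact ih.trans (le_diffAdjoin _ y)

lemma mem_of_pow_mem_of_admissible {A E : IntermediateField K F} (hA : IsDifferential A)
    (h : ReflTransGen (AdjoinStep IsSpecialTranscendental) A E) {x : F} (hx : x ∈ E) {k : ℕ}
    (hk : k ≠ 0) (hxk : x ^ k ∈ A) : x ∈ A := by
  induction h with
  | refl => exact hx
  | tail hAB h ih =>
    obtain ⟨y, hy, rfl⟩ := h
    obtain ⟨p, q, rfl⟩ := exists_div_of_mem_diffAdjoin (isDifferential_of_reflTransGen hA hAB)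
      hy.deriv_mem_adjoin hx
    exact ih (mem_of_pow_mem hy.1 p q hk (le_of_reflTransGen hAB hxk))

/-- A Riccati equation over `A` that is solvable in an admissible extension of `A` is solvable
in `A`. -/
lemma exists_riccati_of_admissible {A E : IntermediateField K F} (hA : IsDifferential A)
    (h : ReflTransGen (AdjoinStep IsSpecialTranscendental) A E) {n : ℕ} {a : ℕ → F}
    (ha : ∀ i, a i ∈ A) (han : a n ≠ 0) {β : F} (hβ : β ∈ E)
    (hr : ∑ i ∈ Finset.range (n + 1), a i * riccati β i = 0) :
    ∃ b ∈ A, ∑ i ∈ Finset.range (n + 1), a i * riccati b i = 0 := by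
  induction h generalizing β with
  | refl => exact ⟨β, hβ, hr⟩
  | tail hAB h ih =>
    obtain ⟨y, hy, rfl⟩ := h
    obtain ⟨b, hb, hbr⟩ := exists_riccati_of_special (isDifferential_of_reflTransGen hA hAB) hy
      (fun i => le_of_reflTransGen hAB (ha i)) han hβ hr
    exact ih hb hbr

/-- The elements allowed in the tower to be constructed: integrals, and transcendental
exponentials of integrals. -/
def IsIntegralOrTransExp (A : IntermediateField K F) (y : F) : Prop :=
  IsIntegralOver A y ∨ (IsExpIntegralOver A y ∧ Transcendental A y)

lemma exists_tower_of_integrals {A : IntermediateField K F} (s : Finset F)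
    (hs : ∀ x ∈ s, x′ ∈ A) :
    ∃ B, ReflTransGen (AdjoinStep IsIntegralOrTransExp) A B ∧ ∀ x ∈ s, x ∈ B := by
  classical
  induction s using Finset.induction_on with
  | empty => exact ⟨A, .refl, by simp⟩
  | insert y s _ ih =>
    obtain ⟨B, hAB, hB⟩ := ih fun x hx => hs x (Finset.mem_insert_of_mem hx)
    refine ⟨diffAdjoin B y, hAB.tail ⟨y, .inl ⟨_, ?_, rfl⟩, rfl⟩, fun x hx => ?_⟩
    · exact le_of_reflTransGen hAB (hs y (Finset.mem_insert_self _ _))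
    · rcases Finset.mem_insert.1 hx with rfl | hx
      · exact mem_diffAdjoin B x
      · exact le_diffAdjoin B y (hB x hx)

variable [Differential.ContainConstants K F]

/-- If all elements of a finite-dimensional space over the constants are integrals over `A`, they
are contained in a tower of extensions of `A` by integrals. -/
lemma exists_tower_of_submodule {A : IntermediateField K F} (W : Submodule (constants F) F)
    [FiniteDimensional (constants F) W] (hW : ∀ x ∈ W, x′ ∈ A) :
    ∃ B, ReflTransGen (AdjoinStep IsIntegralOrTransExp) A B ∧ ∀ x ∈ W, x ∈ B := by
  obtain ⟨s, hs⟩ := Module.Finite.iff_fg.1 ‹FiniteDimensional (constants F) W›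
  obtain ⟨B, hAB, hB⟩ := exists_tower_of_integrals (A := A) s fun x hx =>
    hW x (hs ▸ Submodule.subset_span hx)
  refine ⟨B, hAB, fun x hx => ?_⟩
  rw [← hs] at hx
  induction hx using Submodule.span_induction with
  | mem x hx => exact hB x hx
  | zero => exact zero_mem B
  | add x y _ _ hx hy => exact add_mem hx hy
  | smul c x _ hx =>
    rw [Subfield.smul_def, smul_eq_mul]
    exact mul_mem (bot_le (a := B) (mem_bot_of_deriv_eq_zero K c.2)) hx

variable [Differential K] [DifferentialAlgebra K F]

/-- Finitely many exponentials of integrals over `K` that lie in an admissible extension of `K`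
are contained in a tower of extensions of `K` by transcendental exponentials of integrals. The
generators of the tower form a basis, modulo `Kˣ`, of the group generated by the given
exponentials: this group is torsion-free modulo `Kˣ`. -/
lemma exists_tower_of_exponentials {E : IntermediateField K F}
    (hE : ReflTransGen (AdjoinStep IsSpecialTranscendental) ⊥ E) {s : Set Fˣ} (hs : s.Finite)
    (hsE : s ⊆ fieldUnits E) (hse : s ⊆ expUnits (⊥ : IntermediateField K F)) :
    ∃ B : IntermediateField K F, ReflTransGen (AdjoinStep IsIntegralOrTransExp) ⊥ B ∧
      s ⊆ fieldUnits B := by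
  let N : Submodule ℤ (Additive Fˣ) :=
    AddSubgroup.toIntSubmodule (Subgroup.toAddSubgroup (fieldUnits (⊥ : IntermediateField K F)))
  let s' : Set (Additive Fˣ) := Additive.toMul ⁻¹' s
  have hspan : ∀ G : Subgroup Fˣ, s ⊆ G → ∀ x ∈ Submodule.span ℤ s', Additive.toMul x ∈ G := by
    intro G hG x hx
    exact (Submodule.span_le (p := AddSubgroup.toIntSubmodule (Subgroup.toAddSubgroup G))).2
      (fun y hy => hG hy) hx
  obtain ⟨r, g', hg's, hgen, hind⟩ := exists_basis_modulo N (s := s')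
    (hs.preimage Additive.toMul.injective.injOn) (by
      intro x hx k hk hkx
      have hxE : ((Additive.toMul x : Fˣ) : F) ∈ E := hspan _ hsE x hx
      refine mem_of_pow_mem_of_admissible isDifferential_bot hE hxE
        (Int.natAbs_ne_zero.2 hk) ?_
      have h1 : (Additive.toMul x) ^ k ∈ fieldUnits (⊥ : IntermediateField K F) := hkx
      have h2 : (Additive.toMul x) ^ k.natAbs ∈ fieldUnits (⊥ : IntermediateField K F) := by
        rcases Int.natAbs_eq k with h | h
        · rwa [h, zpow_natCast] at h1
        · rwa [h, zpow_neg, inv_mem_iff, zpow_natCast] at h1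
      simpa using h2)
  let g : Fin r → Fˣ := fun j => Additive.toMul (g' j)
  have hge : ∀ j, g j ∈ expUnits (⊥ : IntermediateField K F) := fun j => hspan _ hse _ (hg's j)
  have hsum : ∀ e : Fin r → ℤ, Additive.toMul (∑ j, e j • g' j) = ∏ j, g j ^ e j := fun e => by
    simp [g]
  have halg := algebraicIndependent_of_expUnits g hge fun e he => hind e (by
    rw [← hsum] at he; exact he)
  have htower : ∀ m ≤ r, ∃ B : IntermediateField K F,
      ReflTransGen (AdjoinStep IsIntegralOrTransExp) ⊥ B ∧
      B ≤ IntermediateField.adjoin K ((fun j => (g j : F)) '' {j | (j : ℕ) < m}) ∧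
      ∀ j : Fin r, (j : ℕ) < m → (g j : F) ∈ B := by
    intro m
    induction m with
    | zero => exact fun _ => ⟨⊥, .refl, bot_le, fun j hj => absurd hj (Nat.not_lt_zero _)⟩
    | succ m ih =>
      intro hm
      obtain ⟨B, hB, hBle, hgB⟩ := ih (by omega)
      have hde : ∀ i, (g i : F)′ = Differential.logDeriv (g i : F) * g i := fun i => by
        rw [Differential.logDeriv, div_mul_cancel₀ _ (g i).ne_zero]
      have htr : Transcendental B (g ⟨m, hm⟩ : F) := by
        have h1 := halg.transcendental_adjoin (s := {j : Fin r | (j : ℕ) < m}) (i := ⟨m, hm⟩)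
          (by simp)
        rw [← IntermediateField.transcendental_adjoin_iff] at h1
        exact h1.of_tower_top_of_subalgebra_le (A := B.toSubalgebra) hBle
      refine ⟨diffAdjoin B (g ⟨m, hm⟩), hB.tail ⟨_, .inr ⟨⟨_, ?_, hde _⟩, htr⟩, rfl⟩, ?_, ?_⟩
      · exact bot_le (a := B) (hge _)
      · set t : Set F := (fun j => (g j : F)) '' {j | (j : ℕ) < m + 1} with ht
        have h1 : ∀ x : K, (algebraMap K F x)′ ∈ IntermediateField.adjoin K t := fun x => by
          rw [deriv_algebraMap]
          exact IntermediateField.algebraMap_mem _ _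
        have h2 : ∀ x ∈ t, x′ ∈ IntermediateField.adjoin K t := by
          rintro _ ⟨i, hi, rfl⟩
          simp only [hde i]
          exact mul_mem (bot_le (a := IntermediateField.adjoin K t) (hge i))
            (IntermediateField.subset_adjoin _ _ ⟨i, hi, rfl⟩)
        refine diffAdjoin_le (deriv_mem_adjoin h1 h2) (hBle.trans ?_) ?_
        · refine IntermediateField.adjoin.mono _ _ _ (Set.image_mono fun i hi => ?_)
          simp only [Set.mem_ofPred_eq] at hi ⊢
          omega
        · exact IntermediateField.subset_adjoin _ _ ⟨⟨m, hm⟩, by simp, rfl⟩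
      · intro j hj
        rcases Nat.lt_succ_iff_lt_or_eq.1 hj with hj | hj
        · exact le_diffAdjoin _ _ (hgB j hj)
        · have : j = ⟨m, hm⟩ := Fin.ext hj
          rw [this]
          exact mem_diffAdjoin _ _
  obtain ⟨B, hB, -, hgB⟩ := htower r le_rfl
  refine ⟨B, hB, fun u hu => ?_⟩
  obtain ⟨e, he⟩ := hgen (Additive.ofMul u) hu
  have h1 : u / ∏ j, g j ^ e j ∈ fieldUnits B := by
    rw [← hsum]
    exact bot_le (a := B) he
  have h2 : ∏ j, g j ^ e j ∈ fieldUnits B :=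
    Subgroup.prod_mem _ fun j _ => Subgroup.zpow_mem _ (hgB j j.2) _
  simpa using mul_mem h1 h2

end Towers

/-! ### Reduction to exponentials and integrals -/

section Solutions

open Relation

variable {K F : Type*} [Field K] [Field F] [Differential F] [Algebra K F]

lemma isSolution_iff {n : ℕ} (a : Fin (n + 1) → K) (y : F) :
    IsSolution a y ↔
      linOp (fun i => if h : i < n + 1 then algebraMap K F (a ⟨i, h⟩) else 0) n y = 0 := by
  rw [IsSolution, linOp_apply, Finset.sum_range]
  have h : ∀ i : ℕ, (derivLin ^ i : F →ₗ[constants F] F) y = (fun x : F => x′)^[i] y := fun i => by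
    rw [Module.End.pow_apply]
    rfl
  simp [h, Fin.is_le]

lemma riccati_mem {A : IntermediateField K F} (hA : IsDifferential A) {β : F} (hβ : β ∈ A)
    (i : ℕ) : riccati β i ∈ A := by
  induction i with
  | zero => exact one_mem A
  | succ i ih => exact add_mem (hA _ ih) (mul_mem hβ ih)

lemma quotCoeff_mem {A : IntermediateField K F} (hA : IsDifferential A) {β : F} (hβ : β ∈ A)
    (i j : ℕ) : quotCoeff β i j ∈ A := by
  induction i generalizing j with
  | zero => exact zero_mem A
  | succ i ih =>
    rcases j with _ | j
    · exact add_mem (hA _ (ih 0)) (riccati_mem hA hβ i)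
    · exact add_mem (hA _ (ih (j + 1))) (ih j)

lemma rightQuotient_mem {A : IntermediateField K F} (hA : IsDifferential A) {β : F} (hβ : β ∈ A)
    {a : ℕ → F} (ha : ∀ i, a i ∈ A) (n j : ℕ) : rightQuotient a β n j ∈ A :=
  sum_mem fun i _ => mul_mem (ha i) (quotCoeff_mem hA hβ i j)

variable [Differential K] [DifferentialAlgebra K F] [Differential.ContainConstants K F]

/-- If an equation over `K` has a full solution space, contained in an admissible extension `E`
of `K`, then there are finitely many exponentials of integrals over `K` in `E` such that, over
any differential field containing them, the solutions are obtained by integrations. -/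
lemma exists_exponentials {E : IntermediateField K F}
    (hE : ReflTransGen (AdjoinStep IsSpecialTranscendental) ⊥ E) (n : ℕ) (a : ℕ → F)
    (ha : ∀ i, a i ∈ (⊥ : IntermediateField K F)) (han : a n ≠ 0)
    (hfull : Module.finrank (constants F) (LinearMap.ker (linOp a n)) = n)
    (hsol : ∀ x, linOp a n x = 0 → x ∈ E) :
    ∃ s : Set Fˣ, s.Finite ∧ s ⊆ fieldUnits E ∧ s ⊆ expUnits (⊥ : IntermediateField K F) ∧
      ∀ B : IntermediateField K F, IsDifferential B → s ⊆ fieldUnits B →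
        ∃ B', ReflTransGen (AdjoinStep IsIntegralOrTransExp) B B' ∧
          ∀ x, linOp a n x = 0 → x ∈ B' := by
  have hbot : IsDifferential (⊥ : IntermediateField K F) := isDifferential_bot
  have hEd := isDifferential_of_reflTransGen hbot hE
  induction n generalizing a with
  | zero =>
    refine ⟨∅, Set.finite_empty, Set.empty_subset _, Set.empty_subset _, fun B _ _ =>
      ⟨B, .refl, fun x hx => ?_⟩⟩
    have : x = 0 := by simpa [linOp_apply, han] using hx
    rw [this]
    exact zero_mem B
  | succ n ih =>
    have hne : LinearMap.ker (linOp a (n + 1)) ≠ ⊥ := by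
      intro hb
      rw [hb, finrank_bot] at hfull
      omega
    obtain ⟨v, hv, hv0⟩ := Submodule.exists_mem_ne_zero_of_ne_bot hne
    have hvE := hsol v hv
    obtain ⟨β, hβ, hr⟩ := exists_riccati_of_admissible hbot hE ha han
      (div_mem (hEd v hvE) hvE) (riccati_logDeriv a (n + 1) hv0 hv)
    obtain ⟨⟨f, hf0, hf, hfsol⟩, hfull', hsurj⟩ := full_of_comp n a han β hr hfull
    obtain ⟨s, hs, hsE, hse, hsB⟩ := ih (rightQuotient a β n) (rightQuotient_mem hbot hβ ha n)
      (by rwa [rightQuotient_leading]) hfull' (fun w hw => by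
        obtain ⟨x, hx, rfl⟩ := hsurj w hw
        have hxE := hsol x hx
        rw [firstOrder_apply]
        exact sub_mem (hEd x hxE) (mul_mem (bot_le (a := E) hβ) hxE))
    refine ⟨insert (Units.mk0 f hf0) s, hs.insert _, Set.insert_subset ?_ hsE,
      Set.insert_subset ?_ hse, fun B hB hsub => ?_⟩
    · exact hsol f hfsol
    · have : Differential.logDeriv f = β := by
        rw [Differential.logDeriv, hf, mul_div_cancel_right₀ _ hf0]
      simpa [this] using hβ
    · rw [Set.insert_subset_iff] at hsub
      obtain ⟨B₁, hB₁, hw⟩ := hsB B hB hsub.2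
      have hfB₁ : f ∈ B₁ := le_of_reflTransGen hB₁ hsub.1
      have := finite_ker_linOp (n + 1) a han
      -- For a solution `x`, the derivative of `x / f` is `(x′ - β x) / f`, and `x′ - β x` solves
      -- the equation of order `n`.
      obtain ⟨B₂, hB₂, hx⟩ := exists_tower_of_submodule (A := B₁)
        ((LinearMap.ker (linOp a (n + 1))).map (LinearMap.mulLeft (constants F) f⁻¹)) (by
          rintro _ ⟨x, hx, rfl⟩
          have h1 : firstOrder β x ∈ B₁ := by
            refine hw _ ?_
            have h2 : linOp a (n + 1) x = 0 := hx
            rwa [linOp_eq_comp a β n hr] at h2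
          have h3 : (f⁻¹ * x)′ = f⁻¹ * firstOrder β x := by
            rw [Derivation.leibniz, Derivation.leibniz_inv, hf, firstOrder_apply]
            simp only [smul_eq_mul]
            field_simp
            ring
          rw [LinearMap.mulLeft_apply, h3]
          exact mul_mem (inv_mem hfB₁) h1)
      refine ⟨B₂, hB₁.trans hB₂, fun x hxs => ?_⟩
      have h4 := mul_mem (le_of_reflTransGen hB₂ hfB₁) (hx (f⁻¹ * x) ⟨x, hxs, rfl⟩)
      rwa [mul_inv_cancel_left₀ hf0] at h4

end Solutions

end LinODE

theorem mainTheorem2 {K F : Type*} [Field K] [Field F] [CharZero K]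
    [Differential K] [Differential F] [Algebra K F] [DifferentialAlgebra K F]
    [Differential.ContainConstants K F]
    (n : ℕ) (a : Fin (n + 1) → K) (ha : a (Fin.last n) ≠ 0)
    (h : ∃ E : IntermediateField K F, LinODE.IsAdmissible E ∧ LinODE.ContainsAllSolutions a E) :
    ∃ E : IntermediateField K F,
      LinODE.IsIntegralTransExpExtension E ∧ LinODE.ContainsAllSolutions a E := by
  open LinODE in
  obtain ⟨E, hE, ⟨v, hv, hvs⟩, hsol⟩ := h
  simp only [isSolution_iff] at hvs hsol
  set b : ℕ → F := fun i => if h : i < n + 1 then algebraMap K F (a ⟨i, h⟩) else 0 with hb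
  have hbn : b n ≠ 0 := by
    have : a ⟨n, n.lt_succ_self⟩ ≠ 0 := ha
    simpa [hb] using this
  have hbot : ∀ i, b i ∈ (⊥ : IntermediateField K F) := by
    intro i
    simp only [hb]
    split_ifs
    · exact IntermediateField.algebraMap_mem _ _
    · exact zero_mem _
  have := finite_ker_linOp n b hbn
  have hfull : Module.finrank (constants F) (LinearMap.ker (linOp b n)) = n := by
    refine le_antisymm (Module.finrank_le_of_rank_le (rank_ker_linOp_le n b hbn)) ?_
    let w : Fin n → LinearMap.ker (linOp b n) := fun i => ⟨v i, (hvs i).1⟩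
    have hw : LinearIndependent (constants F) w :=
      LinearIndependent.of_comp (LinearMap.ker (linOp b n)).subtype hv
    simpa using hw.fintype_card_le_finrank
  have hchain := reflTransGen_of_hasChain hE
  obtain ⟨s, hs, hsE, hse, hsB⟩ := exists_exponentials hchain n b hbot hbn hfull hsol
  obtain ⟨B, hB, hsub⟩ := exists_tower_of_exponentials hchain hs hsE hse
  obtain ⟨B', hB', hx⟩ := hsB B (isDifferential_of_reflTransGen isDifferential_bot hB) hsub
  refine ⟨B', hasChain_of_reflTransGen isDifferential_bot (hB.trans hB'), ⟨v, hv, fun i => ?_⟩, ?_⟩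
  · exact ⟨(isSolution_iff a (v i)).2 (hvs i).1, hx _ (hvs i).1⟩
  · exact fun y hy => hx y ((isSolution_iff a y).1 hy)
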